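/- Let $\alpha<2$ be real, let $L$ be the infinite diagonal matrix with entries $L_{mm}=m^2$ ($m=1,2,3,\dots$), and let $B$ be the infinite matrix whose only nonzero entries are $B_{m,m+1}=B_{m+1,m}=m^\alpha$. Consider $L+zB$ as an operator in $\ell^2$ with domain $\mathrm{Dom}(L)=\{g\in\ell^2:\ (m^2g_m)_m\in\ell^2\}$. For $n\ge 1$ let $E_n(z)=\sum_{k\ge 0}a_k(n,\alpha)z^k$ be the analytic eigenvalue function of $L+zB$ near $z=0$ with $E_n(0)=n^2$; that is, on some disc $|z|<r_n$, $r_n>0$, the function $E_n$ is analytic and there is an analytic $\ell^2$-valued function $\varphi_n$ with $0\ne\varphi_n(z)\in\mathrm{Dom}(L)$, $(L+zB)\varphi_n(z)=E_n(z)\varphi_n(z)$, $\varphi_n(0)=e_n$ (the $n$-th unit vector) and $E_n(0)=n^2$. For every integer $k\ge 1$ there are polynomials $P_k(j,\cdot)$, $j=0,1,2,\dots$, with real coefficients such that for every real $\alpha<2$ the series $$f_\alpha(w)=\sum_{j=0}^\infty P_k(j,\alpha)\,w^j$$ converges to an analytic function on the disc $|w|<1/k$, and for every integer $n>k$ the function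 $E_n$ exists and its $k$-th Taylor coefficient $a_k(n,\alpha)$ at $z=0$ is uniquely determined and equals $$a_k(n,\alpha)=n^{k\alpha-(k-1)}f_\alpha(1/n).$$ -/

import Mathlib

namespace TridiagonalFamily

/-- The diagonal matrix `L` with entries `L k k = k ^ 2`, rows and columns indexed by `1, 2, 3, …`. -/
noncomputable def matL : Matrix ℕ+ ℕ+ ℂ :=
  Matrix.diagonal fun k => ((k : ℕ) : ℂ) ^ 2

/-- The off-diagonal matrix with superdiagonal entries `B k (k + 1) = b k` and
subdiagonal entries `B (k + 1) k = c k`; all other entries vanish. -/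
def matB (b c : ℕ+ → ℂ) : Matrix ℕ+ ℕ+ ℂ := fun i j =>
  if j = i + 1 then b i else if i = j + 1 then c j else 0

/-- The sequence `k ^ α`. -/
noncomputable def powSeq (α : ℝ) (k : ℕ+) : ℂ :=
  ((((k : ℕ) : ℝ) ^ α : ℝ) : ℂ)

/-- The Hilbert space `ℓ²` of square summable complex sequences indexed by `1, 2, 3, …`. -/
abbrev Ell2 : Type := lp (fun _ : ℕ+ => ℂ) 2

/-- The domain of `L` as an operator in `ℓ²`: those `g` in `ℓ²` with `L g` in `ℓ²`. -/
def domL : Set Ell2 :=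
  {g | Memℓp (fun k : ℕ+ => ((k : ℕ) : ℂ) ^ 2 * g k) 2}

/-- `(L + z B) g = w g` for a vector `g` in the domain of `L`, where `B` has the entries
`b k = c k = k ^ α`. Every row of `L + z B` has at most three nonzero entries,
so that the sum over `j` is a finite one. -/
def EigenEq (α : ℝ) (z w : ℂ) (g : Ell2) : Prop :=
  g ∈ domL ∧
    ∀ i : ℕ+, ∑' j : ℕ+, (matL + z • matB (powSeq α) (powSeq α)) i j * g j = w * g i

/-- `E` is an analytic eigenvalue function of `L + z B` with `E 0 = n ^ 2`: on some disc about `0`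
it is analytic, and there is an analytic eigenvector function `φ` for it with `φ 0 = e_n`. -/
def IsEigenvalueFunction (α : ℝ) (n : ℕ+) (E : ℂ → ℂ) : Prop :=
  ∃ r : ℝ, 0 < r ∧ ∃ φ : ℂ → Ell2,
    AnalyticOnNhd ℂ E (Metric.ball 0 r) ∧
    AnalyticOnNhd ℂ φ (Metric.ball 0 r) ∧
    E 0 = ((n : ℕ) : ℂ) ^ 2 ∧
    φ 0 = lp.single 2 n (1 : ℂ) ∧
    ∀ z ∈ Metric.ball (0 : ℂ) r, φ z ≠ 0 ∧ EigenEq α z (E z) (φ z)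

/-- The coefficient of `z ^ k` in the Taylor series of `E` about `0`. -/
noncomputable def taylorCoeff (E : ℂ → ℂ) (k : ℕ) : ℂ :=
  iteratedDeriv k E 0 / (k.factorial : ℂ)

end TridiagonalFamily

open scoped Topology

namespace TridiagonalFamily

/-! Divide the eigenvector by its `n`-th component and compare Taylor coefficients. For m ≠ n, (m² -
n²) c(m, j+1) = ∑_{i ≤ j} a(i+1) c(m, j-i) - m^α c(m+1, j) - (m-1)^α c(m-1, j), and row n gives
a(j+1) = n^α c(n+1, j) + (n-1)^α c(n-1, j). With m = n + d and w = 1/n, m² - n² = n d (2 + d w) and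
m^α = n^α (1 + d w)^α, so the powers of n collect into n^(j(α-1)), and the rest depends on n only
through w (`coeff_eq_of_recursion`).

Since `B` couples neighbours only, order j is supported on |d| ≤ j. Hence the edge of the matrix is
not felt, and only factors with |d| ≤ k are needed; these are power series on |w| < 1/k with
coefficients polynomial in α (`hasPolySeries_eigvalCoeff`). Every eigenvalue function obeys the
recursion, which gives uniqueness.

For existence put φ = R x, with R the reduced resolvent of `L` at n² completed by 1 at n. `L` R is
bounded, and so is `B` R because α ≤ 2; the eigenvalue equation becomes a fixed-point equation for
x, solved by the implicit function theorem. -/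

/-! ### Power series with coefficients polynomial in α -/

/-- For every `α`, the function `F α` is on the disc of radius `ρ` the sum of an absolutely
convergent power series whose coefficients are fixed polynomials evaluated at `α`. -/
def HasPolySeries (ρ : ℝ) (F : ℝ → ℂ → ℂ) : Prop :=
  ∃ P : ℕ → Polynomial ℝ, ∀ α : ℝ, ∀ w ∈ Metric.ball (0 : ℂ) ρ,
    Summable (fun j : ℕ => ‖(((P j).eval α : ℝ) : ℂ) * w ^ j‖) ∧
    HasSum (fun j : ℕ => (((P j).eval α : ℝ) : ℂ) * w ^ j) (F α w)

namespace HasPolySeries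

variable {ρ : ℝ} {F G : ℝ → ℂ → ℂ}

theorem const (c : ℝ) : HasPolySeries ρ (fun _ _ => (c : ℂ)) := by
  refine ⟨fun j => if j = 0 then Polynomial.C c else 0, fun α w _ => ?_⟩
  have h : ∀ j : ℕ, j ≠ 0 →
      ((((if j = 0 then Polynomial.C c else 0 : Polynomial ℝ)).eval α : ℝ) : ℂ) * w ^ j = 0 := by
    intro j hj; simp [hj]
  refine ⟨(hasSum_single 0 fun j hj => ?_).summable, ?_⟩
  · rw [h j hj, norm_zero]
  · simpa using hasSum_single 0 h

theorem zero : HasPolySeries ρ (fun _ _ => 0) := by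
  simpa using const (ρ := ρ) 0

theorem one : HasPolySeries ρ (fun _ _ => 1) := by
  simpa using const (ρ := ρ) 1

theorem add (hF : HasPolySeries ρ F) (hG : HasPolySeries ρ G) :
    HasPolySeries ρ (fun α w => F α w + G α w) := by
  obtain ⟨P, hP⟩ := hF
  obtain ⟨Q, hQ⟩ := hG
  refine ⟨fun j => P j + Q j, fun α w hw => ?_⟩
  have e : ∀ j, (((P j + Q j).eval α : ℝ) : ℂ) * w ^ j =
      (((P j).eval α : ℝ) : ℂ) * w ^ j + (((Q j).eval α : ℝ) : ℂ) * w ^ j := by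
    intro j; simp [add_mul]
  simp only [e]
  refine ⟨?_, (hP α w hw).2.add (hQ α w hw).2⟩
  exact ((hP α w hw).1.add (hQ α w hw).1).of_nonneg_of_le (fun _ => norm_nonneg _)
    fun _ => norm_add_le _ _

theorem mul (hF : HasPolySeries ρ F) (hG : HasPolySeries ρ G) :
    HasPolySeries ρ (fun α w => F α w * G α w) := by
  obtain ⟨P, hP⟩ := hF
  obtain ⟨Q, hQ⟩ := hG
  refine ⟨fun j => ∑ p ∈ Finset.HasAntidiagonal.antidiagonal j, P p.1 * Q p.2, fun α w hw => ?_⟩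
  have e : ∀ j, (((∑ p ∈ Finset.HasAntidiagonal.antidiagonal j, P p.1 * Q p.2).eval α : ℝ) : ℂ) * w ^ j =
      ∑ p ∈ Finset.HasAntidiagonal.antidiagonal j,
        ((((P p.1).eval α : ℝ) : ℂ) * w ^ p.1) * ((((Q p.2).eval α : ℝ) : ℂ) * w ^ p.2) := by
    intro j
    rw [Polynomial.eval_finsetSum]
    push_cast
    rw [Finset.sum_mul]
    refine Finset.sum_congr rfl fun p hp => ?_
    rw [← Finset.HasAntidiagonal.mem_antidiagonal.1 hp]
    simp only [Polynomial.eval_mul]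
    push_cast
    ring
  simp only [e]
  have hs := summable_norm_sum_mul_antidiagonal_of_summable_norm (hP α w hw).1 (hQ α w hw).1
  refine ⟨hs, ?_⟩
  have ht := tsum_mul_tsum_eq_tsum_sum_antidiagonal_of_summable_norm (hP α w hw).1 (hQ α w hw).1
  rw [(hP α w hw).2.tsum_eq, (hQ α w hw).2.tsum_eq] at ht
  rw [ht]
  exact hs.of_norm.hasSum

theorem neg (hF : HasPolySeries ρ F) : HasPolySeries ρ (fun α w => -F α w) := by
  simpa using (const (ρ := ρ) (-1)).mul hF

theorem sub (hF : HasPolySeries ρ F) (hG : HasPolySeries ρ G) :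
    HasPolySeries ρ (fun α w => F α w - G α w) := by
  simpa [sub_eq_add_neg] using hF.add hG.neg

theorem sum {ι : Type*} (s : Finset ι) {F : ι → ℝ → ℂ → ℂ} (h : ∀ i ∈ s, HasPolySeries ρ (F i)) :
    HasPolySeries ρ (fun α w => ∑ i ∈ s, F i α w) := by
  classical
  induction s using Finset.induction_on with
  | empty => simpa using zero
  | insert a s ha ih =>
    simp only [Finset.sum_insert ha]
    exact (h a (Finset.mem_insert_self a s)).add
      (ih fun i hi => h i (Finset.mem_insert_of_mem hi))

theorem norm_mul_lt_one {d : ℝ} (hd : |d| * ρ ≤ 1) {w : ℂ} (hw : w ∈ Metric.ball (0 : ℂ) ρ) :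
    ‖(d : ℂ) * w‖ < 1 := by
  rw [mem_ball_zero_iff] at hw
  rw [norm_mul, Complex.norm_real, Real.norm_eq_abs]
  rcases (abs_nonneg d).eq_or_lt with h | h
  · rw [← h]; simp
  · exact (mul_lt_mul_of_pos_left hw h).trans_le hd

/-- Binomial series: the coefficient of w^j is d^j α(α-1)⋯(α-j+1)/j!, a polynomial in α. -/
theorem one_add_cpow {d : ℝ} (hd : |d| * ρ ≤ 1) :
    HasPolySeries ρ (fun α w => (1 + (d : ℂ) * w) ^ (α : ℂ)) := by
  refine ⟨fun j => Polynomial.C (d ^ j * ((j.factorial : ℝ))⁻¹) * descPochhammer ℝ j,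
    fun α w hw => ?_⟩
  have hdw := norm_mul_lt_one hd hw
  have key : ∀ j, (((Polynomial.C (d ^ j * ((j.factorial : ℝ))⁻¹) * descPochhammer ℝ j).eval α : ℝ)
      : ℂ) * w ^ j = (binomialSeries ℂ (α : ℂ) j fun _ => (d : ℂ) * w) := by
    intro j
    rw [binomialSeries_apply, ← Complex.ofReal_choose, Ring.choose_eq_smul,
      ← descPochhammer_map (Int.castRingHom ℝ), Polynomial.eval_mul, Polynomial.eval_C,
      Polynomial.eval_map, ← Polynomial.eval₂_smulOneHom_eq_smeval]
    simp
    ring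
  simp only [key]
  have hb := Complex.one_add_cpow_hasFPowerSeriesOnBall_zero (a := (α : ℂ))
  have hmem : (d : ℂ) * w ∈ Metric.eball (0 : ℂ) 1 := by
    rw [← ENNReal.ofReal_one, Metric.eball_ofReal]
    simpa using hdw
  refine ⟨?_, by simpa using hb.hasSum hmem⟩
  exact (binomialSeries ℂ (α : ℂ)).summable_norm_apply
    (Metric.eball_subset_eball hb.r_le hmem)

theorem inv_two_add {d : ℝ} (hd : |d| * ρ ≤ 1) :
    HasPolySeries ρ (fun _ w => (2 + (d : ℂ) * w)⁻¹) := by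
  refine ⟨fun j => Polynomial.C (2⁻¹ * (-d / 2) ^ j), fun α w hw => ?_⟩
  have hdw := norm_mul_lt_one hd hw
  have e : ∀ j, (((Polynomial.C (2⁻¹ * (-d / 2) ^ j)).eval α : ℝ) : ℂ) * w ^ j =
      2⁻¹ * (-((d : ℂ) * w) / 2) ^ j := by
    intro j
    simp only [Polynomial.eval_C]
    push_cast
    rw [mul_assoc, ← mul_pow]
    ring
  have hlt : ‖-((d : ℂ) * w) / 2‖ < 1 := by
    rw [norm_div, norm_neg]
    have : ‖(2 : ℂ)‖ = 2 := by simp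
    rw [this]; linarith
  simp only [e]
  have hne : (2 : ℂ) + d * w ≠ 0 := by
    intro h
    have : (d : ℂ) * w = -2 := by linear_combination h
    rw [this] at hdw
    norm_num at hdw
  constructor
  · simp only [norm_mul, norm_pow]
    exact (summable_geometric_of_lt_one (norm_nonneg _) hlt).mul_left _
  · have h := (hasSum_geometric_of_norm_lt_one hlt).mul_left (2⁻¹ : ℂ)
    have e2 : (2 : ℂ)⁻¹ * (1 - -((d : ℂ) * w) / 2)⁻¹ = (2 + (d : ℂ) * w)⁻¹ := by
      rw [← mul_inv]; congr 1; ring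
    rwa [e2] at h

end HasPolySeries

/-- A function that is the sum of a power series on a disc is analytic there. -/
theorem analyticOnNhd_of_hasSum {ρ : ℝ} (hρ : 0 < ρ) {a : ℕ → ℂ} {f : ℂ → ℂ}
    (h : ∀ w ∈ Metric.ball (0 : ℂ) ρ, HasSum (fun j => a j * w ^ j) (f w)) :
    AnalyticOnNhd ℂ f (Metric.ball 0 ρ) := by
  have hr : ENNReal.ofReal ρ ≤ (FormalMultilinearSeries.ofScalars ℂ a).radius := by
    refine ENNReal.le_of_forall_nnreal_lt fun r hr => ?_
    have hr' : (r : ℝ) < ρ := by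
      rwa [← ENNReal.ofReal_coe_nnreal, ENNReal.ofReal_lt_ofReal_iff hρ] at hr
    -- Convergence at the point r forces a_j r^j → 0, so the radius is at least r.
    refine FormalMultilinearSeries.le_radius_of_tendsto _ (l := 0) ?_
    have h0 := (h (r : ℂ) (by simpa using hr')).summable.tendsto_atTop_zero.norm
    simpa using h0
  have hf : HasFPowerSeriesOnBall f (FormalMultilinearSeries.ofScalars ℂ a) 0
      (ENNReal.ofReal ρ) := by
    refine ⟨hr, by simpa using hρ, fun {y} hy => ?_⟩
    rw [Metric.eball_ofReal] at hy
    simpa [FormalMultilinearSeries.ofScalars, mul_comm] using h y hy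
  rw [← Metric.eball_ofReal]
  exact hf.analyticOnNhd

/-! ### Scaled Rayleigh–Schrödinger coefficients -/

/-- The Rayleigh–Schrödinger coefficients of the eigenvector, normalised to have `n`-th component
`1`: the coefficient of `z ^ j` in component `n + d` is `n ^ (j * (α - 1))` times
`eigvecCoeff α (1 / n) j d`. -/
noncomputable def eigvecCoeff (α : ℝ) (w : ℂ) : ℕ → ℤ → ℂ
  | 0 => fun d => if d = 0 then 1 else 0
  | j + 1 => fun d => if d = 0 then 0 else
      -((((d : ℝ) : ℂ))⁻¹ * (2 + ((d : ℝ) : ℂ) * w)⁻¹) *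
        ((1 + ((d : ℝ) : ℂ) * w) ^ (α : ℂ) * eigvecCoeff α w j (d + 1)
          + (1 + (((d - 1 : ℤ) : ℝ) : ℂ) * w) ^ (α : ℂ) * eigvecCoeff α w j (d - 1)
          - ∑ i : Fin (j + 1),
              (eigvecCoeff α w i 1
                + (1 + ((-1 : ℝ) : ℂ) * w) ^ (α : ℂ) * eigvecCoeff α w i (-1)) *
              eigvecCoeff α w (j - i) d)

/-- The scaled Rayleigh–Schrödinger coefficient of `z ^ (j + 1)` in the eigenvalue. -/
noncomputable def eigvalCoeff (α : ℝ) (w : ℂ) (j : ℕ) : ℂ :=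
  eigvecCoeff α w j 1 + (1 + ((-1 : ℝ) : ℂ) * w) ^ (α : ℂ) * eigvecCoeff α w j (-1)

theorem eigvecCoeff_zero (α : ℝ) (w : ℂ) (d : ℤ) :
    eigvecCoeff α w 0 d = if d = 0 then 1 else 0 := by
  rw [eigvecCoeff]

theorem eigvecCoeff_succ (α : ℝ) (w : ℂ) (j : ℕ) (d : ℤ) :
    eigvecCoeff α w (j + 1) d = if d = 0 then 0 else
      -((((d : ℝ) : ℂ))⁻¹ * (2 + ((d : ℝ) : ℂ) * w)⁻¹) *
        ((1 + ((d : ℝ) : ℂ) * w) ^ (α : ℂ) * eigvecCoeff α w j (d + 1)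
          + (1 + (((d - 1 : ℤ) : ℝ) : ℂ) * w) ^ (α : ℂ) * eigvecCoeff α w j (d - 1)
          - ∑ i ∈ Finset.range (j + 1), eigvalCoeff α w i * eigvecCoeff α w (j - i) d) := by
  rw [eigvecCoeff, Finset.sum_range]
  rfl

/-- Each order spreads the support by one site only, because `B` is tridiagonal. -/
theorem eigvecCoeff_eq_zero (α : ℝ) (w : ℂ) (j : ℕ) (d : ℤ) (h : (j : ℤ) < |d|) :
    eigvecCoeff α w j d = 0 := by
  induction j using Nat.strong_induction_on generalizing d with
  | _ j ih =>
    rcases j with _ | j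
    · rw [eigvecCoeff_zero, if_neg]
      rintro rfl
      simp at h
    · rw [eigvecCoeff_succ]
      split_ifs with hd
      · rfl
      · push_cast at h
        have h1 : (j : ℤ) < |d + 1| := by grind
        have h2 : (j : ℤ) < |d - 1| := by grind
        rw [ih j (by omega) _ h1, ih j (by omega) _ h2, Finset.sum_eq_zero]
        · ring
        · intro i _
          rw [ih (j - i) (by omega) d (by omega), mul_zero]

theorem hasPolySeries_eigvecCoeff {ρ : ℝ} (hρ : 0 ≤ ρ) {k : ℕ} (hk : (k : ℝ) * ρ ≤ 1) (j : ℕ)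
    (hj : j + 1 ≤ k) (d : ℤ) : HasPolySeries ρ (fun α w => eigvecCoeff α w j d) := by
  have bound : ∀ e : ℤ, |e| ≤ k → |(e : ℝ)| * ρ ≤ 1 := by
    intro e he
    refine le_trans (mul_le_mul_of_nonneg_right ?_ hρ) hk
    exact_mod_cast he
  induction j using Nat.strong_induction_on generalizing d with
  | _ j ih =>
    by_cases hd : (j : ℤ) < |d|
    · simp only [eigvecCoeff_eq_zero _ _ j d hd]
      exact .zero
    rcases j with _ | j
    · simp only [eigvecCoeff_zero]
      split_ifs
      · exact .one
      · exact .zero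
    · simp only [eigvecCoeff_succ]
      split_ifs with hd0
      · exact .zero
      push_cast at hd
      have ih' : ∀ i ≤ j, ∀ e, HasPolySeries ρ (fun α w => eigvecCoeff α w i e) :=
        fun i hi e => ih i (by omega) (by omega) e
      have hinv : HasPolySeries ρ fun _ w => ((d : ℝ) : ℂ)⁻¹ * (2 + ((d : ℝ) : ℂ) * w)⁻¹ := by
        have := (HasPolySeries.const (ρ := ρ) ((d : ℝ)⁻¹)).mul
          (HasPolySeries.inv_two_add (bound d (by omega)))
        simpa only [Complex.ofReal_inv] using this
      refine hinv.neg.mul (HasPolySeries.sub (HasPolySeries.add ?_ ?_) ?_)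
      · exact (HasPolySeries.one_add_cpow (bound d (by omega))).mul (ih' j le_rfl _)
      -- Order j + 1 has |d| ≤ j + 1, so |d - 1| ≤ j + 2 ≤ k.
      · exact (HasPolySeries.one_add_cpow (bound (d - 1) (by grind))).mul (ih' j le_rfl _)
      · refine HasPolySeries.sum _ fun i hi => ?_
        have hi' : i ≤ j := by simpa [Nat.lt_succ_iff] using hi
        refine HasPolySeries.mul ((ih' i hi' 1).add (HasPolySeries.mul ?_ (ih' i hi' (-1))))
          (ih' (j - i) (by omega) d)
        exact HasPolySeries.one_add_cpow (by simpa using bound (-1) (by simp; omega))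

theorem hasPolySeries_eigvalCoeff {ρ : ℝ} (hρ : 0 ≤ ρ) {k : ℕ} (hk : (k : ℝ) * ρ ≤ 1) (j : ℕ)
    (hj : j + 1 ≤ k) : HasPolySeries ρ (fun α w => eigvalCoeff α w j) := by
  refine (hasPolySeries_eigvecCoeff hρ hk j hj 1).add
    (HasPolySeries.mul (.one_add_cpow ?_) (hasPolySeries_eigvecCoeff hρ hk j hj (-1)))
  refine le_trans (mul_le_mul_of_nonneg_right ?_ hρ) hk
  rw [abs_neg, abs_one]
  exact_mod_cast (by omega : 1 ≤ k)

/-! ### Rescaling the recursion -/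

/-- The entries of `B` next to row `n`, relative to `n ^ α`. -/
theorem natCast_rpow_eq_mul (α : ℝ) {n : ℕ} (hn : 0 < n) (p : ℕ) :
    (((p : ℝ) ^ α : ℝ) : ℂ) = (((n : ℝ) ^ α : ℝ) : ℂ) *
      (1 + ((((p : ℤ) - n : ℤ) : ℝ) : ℂ) * (1 / (n : ℂ))) ^ (α : ℂ) := by
  have hn' : (0 : ℝ) < n := by exact_mod_cast hn
  have e : (1 : ℂ) + ((((p : ℤ) - n : ℤ) : ℝ) : ℂ) * (1 / (n : ℂ)) = (((p : ℝ) / n : ℝ) : ℂ) := by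
    have : (n : ℂ) ≠ 0 := by exact_mod_cast hn.ne'
    push_cast
    field_simp
    ring
  rw [e, ← Complex.ofReal_cpow (by positivity), ← Complex.ofReal_mul,
    ← Real.mul_rpow hn'.le (by positivity), mul_div_cancel₀ _ hn'.ne']

/-- The recursion for the Taylor coefficients of the normalised eigenvector and of the eigenvalue
determines them below order `n`. -/
theorem coeff_eq_of_recursion (α : ℝ) {n : ℕ} (hn : 0 < n) (c : ℕ → ℕ → ℂ) (a : ℕ → ℂ)
    (c_bot : ∀ j, c 0 j = 0) (c_zero : ∀ m, c m 0 = if m = n then 1 else 0)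
    (c_diag : ∀ j, c n (j + 1) = 0)
    (ha : ∀ j, a (j + 1) = (((n : ℝ) ^ α : ℝ) : ℂ) * c (n + 1) j +
      ((((n - 1 : ℕ) : ℝ) ^ α : ℝ) : ℂ) * c (n - 1) j)
    (hc : ∀ m j, m + 1 ≠ n → (((m + 1 : ℕ) : ℂ) ^ 2 - (n : ℂ) ^ 2) * c (m + 1) (j + 1) =
      ∑ i ∈ Finset.range (j + 1), a (i + 1) * c (m + 1) (j - i) -
        (((((m + 1 : ℕ) : ℝ) ^ α : ℝ) : ℂ) * c (m + 2) j + (((m : ℝ) ^ α : ℝ) : ℂ) * c m j))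
    (j : ℕ) (hj : j < n) :
    (∀ m, c m j = (((n : ℝ) ^ ((j : ℝ) * (α - 1)) : ℝ) : ℂ) *
      eigvecCoeff α (1 / (n : ℂ)) j ((m : ℤ) - n)) ∧
    a (j + 1) = (((n : ℝ) ^ (α + (j : ℝ) * (α - 1)) : ℝ) : ℂ) *
      eigvalCoeff α (1 / (n : ℂ)) j := by
  have hnR : (0 : ℝ) < n := by exact_mod_cast hn
  have hnC : (n : ℂ) ≠ 0 := by exact_mod_cast hn.ne'
  induction j using Nat.strong_induction_on with
  | _ j ih =>
    have key : ∀ m, c m j = (((n : ℝ) ^ ((j : ℝ) * (α - 1)) : ℝ) : ℂ) *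
        eigvecCoeff α (1 / (n : ℂ)) j ((m : ℤ) - n) := by
      intro m
      rcases j with _ | j
      · rw [c_zero, eigvecCoeff_zero]
        simp [sub_eq_zero]
      rcases m with _ | m
      -- Index 0 is at distance n from n, beyond the support at an order below n.
      · rw [c_bot, eigvecCoeff_eq_zero, mul_zero]
        simp
        omega
      by_cases hm : m + 1 = n
      · rw [hm, c_diag, eigvecCoeff_succ]
        simp
      have hd : ((m + 1 : ℕ) : ℤ) - n ≠ 0 := by omega
      have h1 := hc m j hm
      obtain ⟨ihc, -⟩ := ih j (by omega) (by omega)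
      have hsum : ∑ i ∈ Finset.range (j + 1), a (i + 1) * c (m + 1) (j - i) =
          (((n : ℝ) ^ (α + (j : ℝ) * (α - 1)) : ℝ) : ℂ) *
          ∑ i ∈ Finset.range (j + 1), eigvalCoeff α (1 / (n : ℂ)) i *
            eigvecCoeff α (1 / (n : ℂ)) (j - i) (((m + 1 : ℕ) : ℤ) - n) := by
        rw [Finset.mul_sum]
        refine Finset.sum_congr rfl fun i hi => ?_
        have hi' : i ≤ j := by simpa [Nat.lt_succ_iff] using hi
        rw [(ih i (by omega) (by omega)).2, (ih (j - i) (by omega) (by omega)).1]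
        -- The total power of n in the product does not depend on i.
        have : α + (j : ℝ) * (α - 1) =
            (α + (i : ℝ) * (α - 1)) + ((j - i : ℕ) : ℝ) * (α - 1) := by
          rw [Nat.cast_sub hi']; ring
        rw [this, Real.rpow_add hnR (α + (i : ℝ) * (α - 1))]
        push_cast
        ring
      rw [hsum, ihc, ihc, natCast_rpow_eq_mul α hn (m + 1), natCast_rpow_eq_mul α hn m] at h1
      rw [eigvecCoeff_succ, if_neg hd]
      have e1 : ((m + 1 : ℕ) : ℤ) - n + 1 = ((m + 2 : ℕ) : ℤ) - n := by push_cast; ring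
      have e2 : ((m + 1 : ℕ) : ℤ) - n - 1 = (m : ℤ) - n := by push_cast; ring
      rw [e1, e2]
      have hs : (((n : ℝ) ^ (α + (j : ℝ) * (α - 1)) : ℝ) : ℂ) =
          (((n : ℝ) ^ α : ℝ) : ℂ) * (((n : ℝ) ^ ((j : ℝ) * (α - 1)) : ℝ) : ℂ) := by
        rw [Real.rpow_add hnR]; push_cast; rfl
      -- The factor n in m² - n² turns n^α into n^(α-1).
      have hs' : (((n : ℝ) ^ (((j + 1 : ℕ) : ℝ) * (α - 1)) : ℝ) : ℂ) * n =
          (((n : ℝ) ^ α : ℝ) : ℂ) * (((n : ℝ) ^ ((j : ℝ) * (α - 1)) : ℝ) : ℂ) := by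
        have : (((j + 1 : ℕ) : ℝ) * (α - 1)) = α + (j : ℝ) * (α - 1) - 1 := by push_cast; ring
        rw [this, Real.rpow_sub_one hnR.ne', Real.rpow_add hnR]
        push_cast
        field_simp
      rw [hs] at h1
      generalize (1 + ((((m + 1 : ℕ) : ℤ) - n : ℤ) : ℝ) * (1 / (n : ℂ)) : ℂ) ^ (α : ℂ) = x1 at h1 ⊢
      generalize (1 + (((m : ℤ) - n : ℤ) : ℝ) * (1 / (n : ℂ)) : ℂ) ^ (α : ℂ) = x2 at h1 ⊢
      generalize (∑ i ∈ Finset.range (j + 1), eigvalCoeff α (1 / (n : ℂ)) i *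
            eigvecCoeff α (1 / (n : ℂ)) (j - i) (((m + 1 : ℕ) : ℤ) - n)) = S at h1 ⊢
      generalize eigvecCoeff α (1 / (n : ℂ)) j (((m + 2 : ℕ) : ℤ) - n) = y1 at h1 ⊢
      generalize eigvecCoeff α (1 / (n : ℂ)) j ((m : ℤ) - n) = y2 at h1 ⊢
      have hne1 : ((((((m + 1 : ℕ) : ℤ) - n : ℤ) : ℝ)) : ℂ) ≠ 0 := by exact_mod_cast hd
      have hne2 : (2 : ℂ) + (((((m + 1 : ℕ) : ℤ) - n : ℤ) : ℝ) : ℂ) * (1 / (n : ℂ)) ≠ 0 := by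
        have : (2 : ℂ) + (((((m + 1 : ℕ) : ℤ) - n : ℤ) : ℝ) : ℂ) * (1 / (n : ℂ)) =
            ((m + 1 + n : ℕ) : ℂ) / n := by
          push_cast; field_simp; ring
        rw [this]
        exact div_ne_zero (by exact_mod_cast (by omega)) hnC
      have hfac : (((m + 1 : ℕ) : ℂ) ^ 2 - (n : ℂ) ^ 2) =
          n * (((((((m + 1 : ℕ) : ℤ) - n : ℤ) : ℝ)) : ℂ) *
            ((2 : ℂ) + (((((m + 1 : ℕ) : ℤ) - n : ℤ) : ℝ) : ℂ) * (1 / (n : ℂ)))) := by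
        push_cast; field_simp; ring
      rw [hfac] at h1
      generalize ((((((m + 1 : ℕ) : ℤ) - n : ℤ) : ℝ)) : ℂ) = D at h1 hne1 hne2 ⊢
      generalize (2 : ℂ) + D * (1 / (n : ℂ)) = T at h1 hne2 ⊢
      generalize (((n : ℝ) ^ (((j + 1 : ℕ) : ℝ) * (α - 1)) : ℝ) : ℂ) = N at hs' ⊢
      refine mul_left_cancel₀ (mul_ne_zero hnC (mul_ne_zero hne1 hne2)) ?_
      rw [h1]
      field_simp
      linear_combination (-S + x1 * y1 + x2 * y2) * hs'
    refine ⟨key, ?_⟩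
    rw [ha, key, key, Real.rpow_add hnR, eigvalCoeff, natCast_rpow_eq_mul α hn (n - 1)]
    have e1 : ((n + 1 : ℕ) : ℤ) - n = 1 := by push_cast; ring
    have e2 : ((n - 1 : ℕ) : ℤ) - n = -1 := by omega
    rw [e1, e2]
    push_cast
    ring

/-! ### The eigenvalue equation in coordinates -/

/-- The components of `g`, indexed by `ℕ`, with a component `0` added at the index `0`. -/
noncomputable def component (g : Ell2) : ℕ → ℂ
  | 0 => 0
  | p + 1 => g p.succPNat

theorem matB_succPNat (b c : ℕ+ → ℂ) (p q : ℕ) :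
    matB b c q.succPNat p.succPNat =
      if p = q + 1 then b q.succPNat else if q = p + 1 then c p.succPNat else 0 := by
  simp only [matB, ← PNat.coe_inj, PNat.add_coe, Nat.succPNat_coe, PNat.one_coe, Nat.succ_eq_add_one,
    Nat.add_right_cancel_iff]

theorem matL_succPNat (p q : ℕ) :
    matL q.succPNat p.succPNat = if q = p then ((q + 1 : ℕ) : ℂ) ^ 2 else 0 := by
  simp only [matL, Matrix.diagonal_apply, ← PNat.coe_inj, Nat.succPNat_coe,
    Nat.succ_eq_add_one, Nat.add_right_cancel_iff]

theorem tsum_row (α : ℝ) (z : ℂ) (g : Ell2) (q : ℕ) :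
    ∑' j : ℕ+, (matL + z • matB (powSeq α) (powSeq α)) q.succPNat j * g j =
      ((q + 1 : ℕ) : ℂ) ^ 2 * component g (q + 1) +
        z * (((((q + 1 : ℕ) : ℝ) ^ α : ℝ) : ℂ) * component g (q + 2) +
          (((q : ℝ) ^ α : ℝ) : ℂ) * component g q) := by
  rw [← Equiv.pnatEquivNat.symm.tsum_eq]
  have hs : ∀ p : ℕ, (Equiv.pnatEquivNat.symm p) = p.succPNat := fun p => rfl
  simp only [hs, Matrix.add_apply, Matrix.smul_apply, smul_eq_mul, matB_succPNat, matL_succPNat]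
  -- For q = 0 truncated subtraction merges q - 1 with q, as the first row has no left neighbour.
  rw [tsum_eq_sum (s := {q - 1, q, q + 1})]
  · rcases q with _ | q
    · simp [component, powSeq]
    · rw [Nat.add_sub_cancel, Finset.sum_insert (by simp; omega),
        Finset.sum_insert (by simp), Finset.sum_singleton]
      have h1 : ¬ q = q + 2 := by omega
      simp [component, powSeq, h1]
      ring
  · intro p hp
    simp only [Finset.mem_insert, Finset.mem_singleton, not_or] at hp
    rw [if_neg (by omega), if_neg (by omega), if_neg (by omega)]
    simp

theorem eigenEq_iff (α : ℝ) (z w : ℂ) (g : Ell2) :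
    EigenEq α z w g ↔ g ∈ domL ∧ ∀ q : ℕ,
      ((q + 1 : ℕ) : ℂ) ^ 2 * component g (q + 1) +
        z * (((((q + 1 : ℕ) : ℝ) ^ α : ℝ) : ℂ) * component g (q + 2) +
          (((q : ℝ) ^ α : ℝ) : ℂ) * component g q) = w * component g (q + 1) := by
  refine and_congr_right fun _ => ⟨fun h q => ?_, fun h i => ?_⟩
  · rw [← tsum_row, h]
    rfl
  · obtain ⟨q, rfl⟩ : ∃ q : ℕ, i = q.succPNat := ⟨i.natPred, (PNat.succPNat_natPred i).symm⟩
    rw [tsum_row, h]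
    rfl

/-! ### Taylor coefficients and the recursion -/

section taylorCoeff

variable {f g : ℂ → ℂ}

theorem taylorCoeff_congr (h : f =ᶠ[𝓝 0] g) (j : ℕ) : taylorCoeff f j = taylorCoeff g j := by
  rw [taylorCoeff, taylorCoeff, h.iteratedDeriv_eq]

theorem taylorCoeff_zero (f : ℂ → ℂ) : taylorCoeff f 0 = f 0 := by
  simp [taylorCoeff]

theorem taylorCoeff_const_succ (c : ℂ) (j : ℕ) : taylorCoeff (fun _ => c) (j + 1) = 0 := by
  simp [taylorCoeff, iteratedDeriv_const]

theorem taylorCoeff_add (hf : AnalyticAt ℂ f 0) (hg : AnalyticAt ℂ g 0) (j : ℕ) :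
    taylorCoeff (fun z => f z + g z) j = taylorCoeff f j + taylorCoeff g j := by
  rw [taylorCoeff, iteratedDeriv_fun_add hf.contDiffAt hg.contDiffAt, add_div]
  rfl

theorem taylorCoeff_mul (hf : AnalyticAt ℂ f 0) (hg : AnalyticAt ℂ g 0) (j : ℕ) :
    taylorCoeff (fun z => f z * g z) j =
      ∑ i ∈ Finset.range (j + 1), taylorCoeff f i * taylorCoeff g (j - i) := by
  rw [taylorCoeff, iteratedDeriv_fun_mul hf.contDiffAt hg.contDiffAt, Finset.sum_div]
  refine Finset.sum_congr rfl fun i hi => ?_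
  have hi' : i ≤ j := by simpa [Nat.lt_succ_iff] using hi
  rw [taylorCoeff, taylorCoeff, Nat.cast_choose ℂ hi']
  have h1 := fun m : ℕ => (Nat.cast_ne_zero (R := ℂ)).2 m.factorial_ne_zero
  field_simp [h1 j, h1 i, h1 (j - i)]

theorem taylorCoeff_const_mul (c : ℂ) (f : ℂ → ℂ) (j : ℕ) :
    taylorCoeff (fun z => c * f z) j = c * taylorCoeff f j := by
  rw [taylorCoeff, iteratedDeriv_const_mul_field, mul_div_assoc]
  rfl

theorem taylorCoeff_id_mul_succ (hf : AnalyticAt ℂ f 0) (j : ℕ) :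
    taylorCoeff (fun z => z * f z) (j + 1) = taylorCoeff f j := by
  rw [taylorCoeff_mul (f := fun z => z) analyticAt_id hf, Finset.sum_eq_single 1]
  · simp [taylorCoeff]
  · intro i _ hi
    rcases i with _ | _ | i
    · simp [taylorCoeff]
    · exact absurd rfl hi
    · simp [taylorCoeff, iteratedDeriv_succ', deriv_id'']
  · simp

end taylorCoeff

/-- The Taylor coefficients of an eigenvalue function below order `n`. -/
theorem taylorCoeff_eigenvalue (α : ℝ) (n : ℕ+) {E : ℂ → ℂ} (hE : IsEigenvalueFunction α n E)
    (j : ℕ) (hj : j < (n : ℕ)) :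
    taylorCoeff E (j + 1) =
      ((((n : ℕ) : ℝ) ^ (α + (j : ℝ) * (α - 1)) : ℝ) : ℂ) *
        eigvalCoeff α (1 / ((n : ℕ) : ℂ)) j := by
  obtain ⟨r, hr, φ, hEa, hφ, hE0, hφ0, hev⟩ := hE
  have hmem : (0 : ℂ) ∈ Metric.ball (0 : ℂ) r := Metric.mem_ball_self hr
  have hEa0 := hEa 0 hmem
  have hG : ∀ m, AnalyticAt ℂ (fun z => component (φ z) m) 0 := by
    rintro (_ | m)
    · exact analyticAt_const
    · exact ((lp.evalCLM ℂ (fun _ : ℕ+ => ℂ) 2 m.succPNat).analyticAt _).comp (hφ 0 hmem)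
  have hG0 : ∀ m, component (φ 0) m = if m = (n : ℕ) then 1 else 0 := by
    rintro (_ | m)
    · rw [if_neg n.pos.ne]; rfl
    · rw [hφ0]
      have : (m + 1 = (n : ℕ)) ↔ (m.succPNat = n) := by rw [← PNat.coe_inj]; rfl
      simp only [component, this, lp.single_apply, Pi.single_apply]
  have hGn : component (φ 0) n ≠ 0 := by rw [hG0]; simp
  set h : ℕ → ℂ → ℂ := fun m z => component (φ z) m / component (φ z) n with hh
  have ha : ∀ m, AnalyticAt ℂ (h m) 0 := fun m => (hG m).div (hG n) hGn
  have hrow : ∀ q : ℕ, (fun z => ((q + 1 : ℕ) : ℂ) ^ 2 * h (q + 1) z +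
        z * (((((q + 1 : ℕ) : ℝ) ^ α : ℝ) : ℂ) * h (q + 2) z +
          (((q : ℝ) ^ α : ℝ) : ℂ) * h q z)) =ᶠ[𝓝 0] fun z => E z * h (q + 1) z := by
    intro q
    filter_upwards [Metric.ball_mem_nhds (0 : ℂ) hr] with z hz
    have := ((eigenEq_iff _ _ _ _).1 (hev z hz).2).2 q
    simp only [hh]
    rw [mul_div_assoc' (E z), ← this]
    ring
  have hone : h n =ᶠ[𝓝 0] fun _ => 1 := by
    filter_upwards [(hG n).continuousAt.eventually_ne hGn] with z hz using div_self hz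
  -- Coefficient of z^(i+1) in each row; the constant term n² of E is split off the product.
  have hcoeff : ∀ q i : ℕ, ((q + 1 : ℕ) : ℂ) ^ 2 * taylorCoeff (h (q + 1)) (i + 1) +
      (((((q + 1 : ℕ) : ℝ) ^ α : ℝ) : ℂ) * taylorCoeff (h (q + 2)) i +
        (((q : ℝ) ^ α : ℝ) : ℂ) * taylorCoeff (h q) i) =
      ∑ l ∈ Finset.range (i + 1), taylorCoeff E (l + 1) * taylorCoeff (h (q + 1)) (i - l) +
        ((n : ℕ) : ℂ) ^ 2 * taylorCoeff (h (q + 1)) (i + 1) := by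
    intro q i
    have h0 := ha q
    have h1 := ha (q + 1)
    have h2 := ha (q + 2)
    have hB : AnalyticAt ℂ (fun z => ((((q + 1 : ℕ) : ℝ) ^ α : ℝ) : ℂ) * h (q + 2) z +
        (((q : ℝ) ^ α : ℝ) : ℂ) * h q z) 0 := by fun_prop
    have := taylorCoeff_congr (hrow q) (i + 1)
    rw [taylorCoeff_add (by fun_prop) (by fun_prop), taylorCoeff_const_mul,
      taylorCoeff_id_mul_succ hB, taylorCoeff_add (by fun_prop) (by fun_prop),
      taylorCoeff_const_mul, taylorCoeff_const_mul, taylorCoeff_mul hEa0 h1,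
      Finset.sum_range_succ'] at this
    rw [this, taylorCoeff_zero E, hE0]
    simp
  have hdiag0 : taylorCoeff (h n) 0 = 1 := by
    rw [taylorCoeff_congr hone, taylorCoeff_zero]
  have hdiag : ∀ i, taylorCoeff (h n) (i + 1) = 0 := by
    intro i
    rw [taylorCoeff_congr hone, taylorCoeff_const_succ]
  refine (coeff_eq_of_recursion α n.pos (fun m => taylorCoeff (h m)) (taylorCoeff E)
    ?_ ?_ hdiag ?_ ?_ j hj).2
  · intro i
    have : h 0 = fun _ => 0 := by ext z; simp [hh, component]
    rcases i with _ | i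
    · simp [this, taylorCoeff_zero]
    · rw [this, taylorCoeff_const_succ]
  · intro m
    simp [taylorCoeff_zero, hh, hG0]
  · intro i
    obtain ⟨q, hq⟩ : ∃ q, (n : ℕ) = q + 1 := ⟨n.natPred, (PNat.natPred_add_one n).symm⟩
    have := hcoeff q i
    rw [← hq, hdiag] at this
    simp only [mul_zero, zero_add, add_zero] at this
    -- In row n the normalisation leaves only the term l = i, namely a(i+1).
    rw [Finset.sum_range_succ, Nat.sub_self, hdiag0, mul_one, Finset.sum_eq_zero, zero_add] at this
    · rw [← this, hq, Nat.add_sub_cancel]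
    · intro l hl
      obtain ⟨s, hs⟩ : ∃ s, i - l = s + 1 := ⟨i - l - 1, by have := Finset.mem_range.1 hl; omega⟩
      rw [hs, hdiag, mul_zero]
  · intro m i _
    linear_combination hcoeff m i

/-! ### Existence of the eigenvalue function -/

/-- Bounded weights along a map that is injective on their support act on `ℓ²`. -/
theorem exists_weighted_comp (d : ℕ+ → ℂ) (σ : ℕ+ → ℕ+) {C : ℝ} (hd : ∀ m, ‖d m‖ ≤ C)
    (hσ : Set.InjOn σ {m | d m ≠ 0}) :
    ∃ T : Ell2 →L[ℂ] Ell2, ∀ g m, T g m = d m * g (σ m) := by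
  have hC : 0 ≤ C := (norm_nonneg _).trans (hd 1)
  have h2 : (0 : ℝ) < (2 : ENNReal).toReal := by simp
  have bound : ∀ (g : Ell2) (s : Finset ℕ+),
      ∑ m ∈ s, ‖d m * g (σ m)‖ ^ (2 : ENNReal).toReal ≤ (C * ‖g‖) ^ (2 : ENNReal).toReal := by
    intro g s
    classical
    calc ∑ m ∈ s, ‖d m * g (σ m)‖ ^ (2 : ENNReal).toReal
        = ∑ m ∈ s with d m ≠ 0, ‖d m * g (σ m)‖ ^ (2 : ENNReal).toReal := by
          rw [Finset.sum_filter_of_ne]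
          intro m _ hm h0
          simp [h0] at hm
      _ ≤ ∑ m ∈ s with d m ≠ 0, C ^ (2 : ENNReal).toReal * ‖g (σ m)‖ ^ (2 : ENNReal).toReal := by
          refine Finset.sum_le_sum fun m _ => ?_
          rw [norm_mul, Real.mul_rpow (norm_nonneg _) (norm_nonneg _)]
          exact mul_le_mul_of_nonneg_right (Real.rpow_le_rpow (norm_nonneg _) (hd m) h2.le)
            (by positivity)
      _ = C ^ (2 : ENNReal).toReal *
            ∑ m ∈ ({m ∈ s | d m ≠ 0} : Finset ℕ+).image σ, ‖g m‖ ^ (2 : ENNReal).toReal := by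
          rw [Finset.sum_image, Finset.mul_sum]
          intro a ha b hb hab
          exact hσ (Finset.mem_filter.1 ha).2 (Finset.mem_filter.1 hb).2 hab
      _ ≤ C ^ (2 : ENNReal).toReal * ‖g‖ ^ (2 : ENNReal).toReal :=
          mul_le_mul_of_nonneg_left (lp.sum_rpow_le_norm_rpow h2 g _) (by positivity)
      _ = (C * ‖g‖) ^ (2 : ENNReal).toReal := (Real.mul_rpow hC (norm_nonneg _)).symm
  let T₀ : Ell2 →ₗ[ℂ] Ell2 :=
    { toFun := fun g => ⟨fun m => d m * g (σ m), memℓp_gen' (bound g)⟩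
      map_add' := fun f g => by
        ext m
        exact mul_add _ _ _
      map_smul' := fun c g => by
        ext m
        exact mul_left_comm _ _ _ }
  refine ⟨T₀.mkContinuous C fun g => ?_, fun g m => rfl⟩
  exact lp.norm_le_of_forall_sum_le h2 (by positivity) (bound g)

/-- The analytic solution of `x = e + z • (l(x) V x - W x)` near `z = 0`. -/
theorem exists_analytic_solution {X : Type*} [NormedAddCommGroup X] [NormedSpace ℂ X]
    [CompleteSpace X] (e : X) (W V : X →L[ℂ] X) (l : X →L[ℂ] ℂ) :
    ∃ r : ℝ, 0 < r ∧ ∃ x : ℂ → X, AnalyticOnNhd ℂ x (Metric.ball 0 r) ∧ x 0 = e ∧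
      ∀ z ∈ Metric.ball (0 : ℂ) r, x z = e + z • (l (x z) • V (x z) - W (x z)) := by
  let f : ℂ × X → X := fun p => p.2 - e - p.1 • (l p.2 • V p.2 - W p.2)
  have hf : ContDiff ℂ ⊤ f := by fun_prop
  have hfu : ContDiffAt ℂ ⊤ f (0, e) := hf.contDiffAt
  -- At z = 0 the equation is x - e = 0, so its derivative in x is the identity.
  have hinr : fderiv ℂ f (0, e) ∘L .inr ℂ ℂ X = ContinuousLinearMap.id ℂ X := by
    have h1 : HasFDerivAt (fun x : X => f (0, x)) (fderiv ℂ f (0, e) ∘L .inr ℂ ℂ X) e :=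
      (hfu.differentiableAt (by simp)).hasFDerivAt.comp e (hasFDerivAt_prodMk_right (0 : ℂ) e)
    have h2 : HasFDerivAt (fun x : X => f (0, x)) (ContinuousLinearMap.id ℂ X) e := by
      have : (fun x : X => f (0, x)) = fun x => x - e := by
        ext x; simp [f]
      rw [this]
      exact (hasFDerivAt_id e).sub_const e
    exact h1.unique h2
  have hinv : (fderiv ℂ f (0, e) ∘L .inr ℂ ℂ X).IsInvertible := by
    rw [hinr]
    exact ⟨ContinuousLinearEquiv.refl ℂ X, rfl⟩
  let x := hfu.implicitFunction (by simp) hinv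
  have hx : AnalyticAt ℂ x 0 :=
    (hfu.contDiffAt_implicitFunction (by simp) hinv).analyticAt
  have hx0 : x 0 = e := hfu.implicitFunction_apply_self (by simp) hinv
  have hev : ∀ᶠ z in 𝓝 (0 : ℂ), f (z, x z) = f (0, e) :=
    hfu.eventually_apply_implicitFunction (by simp) hinv
  obtain ⟨r, hr, h⟩ := Metric.eventually_nhds_iff_ball.1 (hx.eventually_analyticAt.and hev)
  refine ⟨r, hr, x, fun z hz => (h z hz).1, hx0, fun z hz => ?_⟩
  have := (h z hz).2
  simp only [f, sub_self, zero_smul] at this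
  rw [sub_sub, sub_eq_zero] at this
  exact this

/-- The entries of the reduced resolvent of `L` at `n ^ 2`, with the entry `1` at `n`. -/
noncomputable def resolventWeight (n p : ℕ) : ℂ :=
  if p = n then 1 else ((p : ℂ) ^ 2 - (n : ℂ) ^ 2)⁻¹

theorem resolventWeight_self (n : ℕ) : resolventWeight n n = 1 := if_pos rfl

theorem sq_sub_sq_ne_zero {n p : ℕ} (h : p ≠ n) : (p : ℂ) ^ 2 - (n : ℂ) ^ 2 ≠ 0 := by
  rw [sub_ne_zero]
  exact_mod_cast fun e => h (Nat.pow_left_injective two_ne_zero e)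

/-- Distinct integer squares differ by at least 1, so p² ≤ |p² - n²| + n² ≤ (n² + 1)|p² - n²|. -/
theorem sq_mul_norm_resolventWeight_le (n p : ℕ) :
    (p : ℝ) ^ 2 * ‖resolventWeight n p‖ ≤ (n : ℝ) ^ 2 + 1 := by
  by_cases h : p = n
  · rw [h, resolventWeight_self]
    simp
  · have h1 : (1 : ℝ) ≤ |(p : ℝ) ^ 2 - (n : ℝ) ^ 2| := by
      have : (p : ℤ) ^ 2 - (n : ℤ) ^ 2 ≠ 0 := by
        rw [sub_ne_zero]
        exact_mod_cast fun e => h (Nat.pow_left_injective two_ne_zero e)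
      exact_mod_cast Int.one_le_abs this
    have h2 : ‖resolventWeight n p‖ = |(p : ℝ) ^ 2 - (n : ℝ) ^ 2|⁻¹ := by
      rw [resolventWeight, if_neg h, norm_inv]
      have : (p : ℂ) ^ 2 - (n : ℂ) ^ 2 = (((p : ℝ) ^ 2 - (n : ℝ) ^ 2 : ℝ) : ℂ) := by push_cast; rfl
      rw [this, Complex.norm_real, Real.norm_eq_abs]
    rw [h2, mul_inv_le_iff₀ (by linarith)]
    nlinarith [le_abs_self ((p : ℝ) ^ 2 - (n : ℝ) ^ 2), sq_nonneg (n : ℝ)]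

theorem norm_rpow_mul_resolventWeight_le {α : ℝ} (hα : α ≤ 2) (n : ℕ) {p q : ℕ} (hp : 1 ≤ p)
    (hpq : p ≤ q) : ‖(((p : ℝ) ^ α : ℝ) : ℂ) * resolventWeight n q‖ ≤ (n : ℝ) ^ 2 + 1 := by
  have hp' : (1 : ℝ) ≤ p := by exact_mod_cast hp
  have hpq' : (p : ℝ) ≤ q := by exact_mod_cast hpq
  rw [norm_mul, Complex.norm_real, Real.norm_of_nonneg (by positivity)]
  refine le_trans (mul_le_mul_of_nonneg_right ?_ (norm_nonneg _))
    (sq_mul_norm_resolventWeight_le n q)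
  calc (p : ℝ) ^ α ≤ (p : ℝ) ^ (2 : ℝ) := Real.rpow_le_rpow_of_exponent_le hp' hα
    _ = (p : ℝ) ^ 2 := by norm_cast
    _ ≤ (q : ℝ) ^ 2 := by gcongr

/-- The analytic eigenvalue function exists. -/
theorem exists_isEigenvalueFunction {α : ℝ} (hα : α ≤ 2) (n : ℕ+) :
    ∃ E : ℂ → ℂ, IsEigenvalueFunction α n E := by
  set ρ := resolventWeight n with hρ
  have hpos : ∀ m : ℕ+, (1 : ℝ) ≤ ((m : ℕ) : ℝ) ^ 2 := fun m =>
    one_le_pow₀ (by exact_mod_cast m.pos)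
  -- D is `L` R; its boundedness puts R x into `domL`.
  obtain ⟨D, hD⟩ := exists_weighted_comp (fun m => ((m : ℕ) : ℂ) ^ 2 * ρ m) id
    (C := ((n : ℕ) : ℝ) ^ 2 + 1)
    (fun m => by simpa using sq_mul_norm_resolventWeight_le n m) Function.injective_id.injOn
  obtain ⟨R, hR⟩ := exists_weighted_comp (fun m => ρ m) id (C := ((n : ℕ) : ℝ) ^ 2 + 1)
    (fun m => le_trans (le_mul_of_one_le_left (norm_nonneg _) (hpos m))
      (sq_mul_norm_resolventWeight_le n m)) Function.injective_id.injOn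
  obtain ⟨Q, hQ⟩ := exists_weighted_comp (fun m => if m = n then 0 else 1) id (C := 1)
    (fun m => by split_ifs <;> simp) Function.injective_id.injOn
  -- S₁ and S₂ are the upper and lower diagonals of `B` R. In S₂ the first row gets weight 0, since
  -- its shifted index is meaningless.
  obtain ⟨S₁, hS₁⟩ := exists_weighted_comp
    (fun m => ((((m : ℕ) : ℝ) ^ α : ℝ) : ℂ) * ρ (m + 1)) (fun m => m + 1)
    (C := ((n : ℕ) : ℝ) ^ 2 + 1)
    (fun m => norm_rpow_mul_resolventWeight_le hα n m.pos (Nat.le_succ _))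
    (add_left_injective 1).injOn
  obtain ⟨S₂, hS₂⟩ := exists_weighted_comp
    (fun m => if m.natPred = 0 then 0 else (((m.natPred : ℝ) ^ α : ℝ) : ℂ) * ρ m.natPred)
    (fun m => (m.natPred - 1).succPNat) (C := ((n : ℕ) : ℝ) ^ 2 + 1)
    (fun m => by
      split_ifs with h
      · rw [norm_zero]; positivity
      · exact norm_rpow_mul_resolventWeight_le hα n (Nat.one_le_iff_ne_zero.2 h) le_rfl)
    (by
      intro a ha b hb hab
      have ha' : a.natPred ≠ 0 := fun h => ha (if_pos h)
      have hb' : b.natPred ≠ 0 := fun h => hb (if_pos h)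
      have := Nat.succPNat_injective hab
      exact PNat.natPred_injective (by omega))
  set S := S₁ + S₂
  have hS : ∀ x q, S x (Nat.succPNat q) =
      ((((q + 1 : ℕ) : ℝ) ^ α : ℝ) : ℂ) * component (R x) (q + 2) +
        (((q : ℝ) ^ α : ℝ) : ℂ) * component (R x) q := by
    intro x q
    have h0 : S x (Nat.succPNat q) = S₁ x q.succPNat + S₂ x q.succPNat := rfl
    rw [h0, hS₁, hS₂]
    congr 1
    · have : q.succPNat + 1 = (q + 1).succPNat := rfl
      simp only [component, hR, this, id]
      rw [mul_assoc]
      rfl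
    · rcases q with _ | q
      · simp [component]
      · simp only [component, hR, id, Nat.natPred_succPNat]
        exact mul_assoc _ _ _
  -- Q removes component n, which fixes x_n = 1; row n then forces E = n² + z (S x)_n.
  obtain ⟨r, hr, x, hxa, hx0, hx⟩ := exists_analytic_solution (lp.single 2 n (1 : ℂ) : Ell2)
    (Q ∘L S) (Q ∘L R) (lp.evalCLM ℂ (fun _ : ℕ+ => ℂ) 2 n ∘L S)
  have hxm : ∀ z ∈ Metric.ball (0 : ℂ) r, ∀ m, x z m = (lp.single 2 n (1 : ℂ) : Ell2) m +
      z * (S (x z) n * Q (R (x z)) m - Q (S (x z)) m) := by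
    intro z hz m
    exact congrArg (fun y : Ell2 => y m) (hx z hz)
  have hxn : ∀ z ∈ Metric.ball (0 : ℂ) r, x z n = 1 := by
    intro z hz
    rw [hxm z hz, hQ, hQ]
    simp
  have hxne : ∀ z ∈ Metric.ball (0 : ℂ) r, ∀ m, m ≠ n →
      x z m + z * S (x z) m = z * S (x z) n * (ρ m * x z m) := by
    intro z hz m hm
    have := hxm z hz m
    rw [hQ, hQ, lp.single_apply_ne _ _ _ hm] at this
    simp only [if_neg hm, id, one_mul, hR, zero_add] at this
    linear_combination this
  have h0 : (0 : ℂ) ∈ Metric.ball (0 : ℂ) r := Metric.mem_ball_self hr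
  refine ⟨fun z => ((n : ℕ) : ℂ) ^ 2 + z * S (x z) n, r, hr, fun z => R (x z), ?_, ?_, ?_, ?_, ?_⟩
  · intro z hz
    have : AnalyticAt ℂ (fun z => S (x z) n) z :=
      ((lp.evalCLM ℂ (fun _ : ℕ+ => ℂ) 2 n ∘L S).analyticAt _).comp (hxa z hz)
    exact analyticAt_const.add (analyticAt_id.mul this)
  · intro z hz
    exact (R.analyticAt _).comp (hxa z hz)
  · simp
  · ext m
    change R (x 0) m = _
    rw [hx0, hR]
    by_cases hm : m = n
    · subst hm
      rw [hρ, resolventWeight_self, one_mul]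
      rfl
    · rw [id, lp.single_apply_ne _ _ _ hm, mul_zero]
  · intro z hz
    refine ⟨fun h => ?_, (eigenEq_iff _ _ _ _).2 ⟨?_, fun q => ?_⟩⟩
    · have h1 : R (x z) n = 1 := by
        rw [hR, id, hxn z hz, hρ, resolventWeight_self, one_mul]
      change R (x z) = 0 at h
      rw [h] at h1
      exact zero_ne_one h1
    · have : (fun k : ℕ+ => ((k : ℕ) : ℂ) ^ 2 * R (x z) k) = D (x z) := by
        ext m
        rw [hD, hR, mul_assoc]
      simp only [domL, Set.mem_ofPred_eq]
      rw [this]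
      exact lp.memℓp _
    · rw [← hS]
      have hc : component (R (x z)) (q + 1) = ρ (q + 1) * x z q.succPNat := hR _ _
      rw [hc]
      by_cases hq : q.succPNat = n
      · have hq' : q + 1 = (n : ℕ) := by rw [← hq]; rfl
        rw [hq, hq', hxn z hz, hρ, resolventWeight_self]
        ring
      · have hq' : q + 1 ≠ (n : ℕ) := fun h => hq (PNat.coe_inj.1 h)
        have e1 := hxne z hz _ hq
        have e2 : (((q + 1 : ℕ) : ℂ) ^ 2 - ((n : ℕ) : ℂ) ^ 2) * ρ (q + 1) = 1 := by
          rw [hρ, resolventWeight, if_neg hq', mul_inv_cancel₀ (sq_sub_sq_ne_zero hq')]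
        have e3 : ((q.succPNat : ℕ+) : ℕ) = q + 1 := rfl
        rw [e3] at e1
        linear_combination e1 + x z q.succPNat * e2

end TridiagonalFamily

/-! ### The theorem -/

theorem lemma4 (k : ℕ) (hk : 1 ≤ k) :
    ∃ P : ℕ → Polynomial ℝ, ∀ α : ℝ, α < 2 →
      ∃ f : ℂ → ℂ,
        AnalyticOnNhd ℂ f (Metric.ball 0 (1 / (k : ℝ))) ∧
        (∀ w ∈ Metric.ball (0 : ℂ) (1 / (k : ℝ)),
          HasSum (fun j : ℕ => (((P j).eval α : ℝ) : ℂ) * w ^ j) (f w)) ∧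
        ∀ n : ℕ+, k < (n : ℕ) →
          (∃ E : ℂ → ℂ, TridiagonalFamily.IsEigenvalueFunction α n E) ∧
          ∀ E : ℂ → ℂ, TridiagonalFamily.IsEigenvalueFunction α n E →
            TridiagonalFamily.taylorCoeff E k =
              ((((n : ℕ) : ℝ) ^ ((k : ℝ) * α - ((k : ℝ) - 1)) : ℝ) : ℂ) *
                f (1 / ((n : ℕ) : ℂ)) := by
  -- The eigenvalue coefficient of order j + 1 uses the eigenvector only at order j and below.
  obtain ⟨j, rfl⟩ : ∃ j, k = j + 1 := ⟨k - 1, by omega⟩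
  have hρ : (0 : ℝ) < 1 / ((j + 1 : ℕ) : ℝ) := by positivity
  obtain ⟨P, hP⟩ := TridiagonalFamily.hasPolySeries_eigvalCoeff hρ.le (k := j + 1)
    (by rw [mul_one_div_cancel (by positivity)]) j le_rfl
  refine ⟨P, fun α hα => ⟨fun w => TridiagonalFamily.eigvalCoeff α w j,
    TridiagonalFamily.analyticOnNhd_of_hasSum hρ fun w hw => (hP α w hw).2,
    fun w hw => (hP α w hw).2,
    fun n hn => ⟨TridiagonalFamily.exists_isEigenvalueFunction hα.le n, fun E hE => ?_⟩⟩⟩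
  rw [TridiagonalFamily.taylorCoeff_eigenvalue α n hE j (by omega)]
  have : α + (j : ℝ) * (α - 1) = ((j + 1 : ℕ) : ℝ) * α - (((j + 1 : ℕ) : ℝ) - 1) := by
    push_cast; ring
  rw [this]
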